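/- **Universal verifiability of the Remark! exam protocol, general case.** *Messages and attacker.* Messages are terms of the free algebra generated by atoms (questions, answers, marks, encryption coins), role constants $C,E$, private keys $sk_P$ of the principals $P$ (the mixnet $N$, the exam authority $A$, candidates, examiners), the secret exponents $x_C,x_E$ of the mixnet, and the constructors $pk$, $\exp$, $pseudo\_pub$, $pseudo\_priv$, $sign$, $enc$ and tupling, with the rewrite rules $decrypt(enc(m,pk(k),r),k)=m$, $decrypt(enc(m,pseudo\_pub(pk(k),x),r),pseudo\_priv(k,\exp(x)))=m$, $checksign(sign(m,k),pk(k))=m$, $checksign(sign(m,pseudo\_priv(k,\exp(x))),pseudo\_pub(pk(k),x))=m$. Put $pk_A=pk(sk_A)$, $pk_N=pk(sk_N)$. A corrupted principal reveals its private key to a Dolev–Yao attacker, who sees all messages, can send any derivable message, can post any derivable entry in the pseudonym section of the bulletin board, and, if $A$ is corrupted, can post any derivable message in the name of $A$. *Protocol.* The mixnet posts, for each registered public key $pk(k)$ of role $R$, the entry $(i,\exp(x_R),R,sign((i,\exp(x_R),R),sk_N))$ with pseudonym $i=pseudo\_pub(pk(k),x_R)$; at any time it may also send $enc((x_C,sign(x_C,sk_N)),pk_A,r)$.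 The authority $A$ posts encrypted signed questions for candidate pseudonyms; a candidate with pseudonym $i$ sends to $A$ the signed and encrypted test $(q,a,i)$; $A$ posts the *receipt* $enc(((q,a,i),sign((q,a,i),sk_A)),i,r)$ (at most one per pseudonym) and then passes the test to the examiner as $(b,sign(b,sk_A))$ encrypted under the examiner's pseudonym $e$; the examiner returns $(M,sign_e(M))$ encrypted for $A$, where $M=(b,sign(b,sk_A),m)$ with a mark $m$; $A$ checks it and posts the *notification* $enc((M,sign_e(M)),i,r')$ (at most one per pseudonym). Here $b$ is, throughout an execution, either the plain test $(q,a,i)$ or the test with the designated examiner, $(q,a,i,e)$; the results hold for both formats. One examiner, with pseudonym $e$ read by the auditor from a bulletin-board entry, marks all tests. *Relations.* For an execution: $I_r$ is the set of candidate pseudonyms posted by the mixnet; $(i,(q,a))\in Accepted$ iff some receipt on the board is an encryption under $i$ of a pair whose second component is a signature of $A$ on $(q,a,i)$; $(i,(q,a),m)\in Marked$ iff some notification is an encryption of a pair whose second component is a signature, valid for $e$, on a triple consisting of the test $b$ of $(q,a,i)$, some term, and $m$; $(i,m)\in Assigned$ iff some notification is an encryption under $i$ of a pair whose first component is a triple with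 last entry $m$. $Correct$ is an arbitrary function from tests to marks. *Tests.* After the exam the auditor reads the board (all receipts, notifications and pseudonym posts, in any numbers) and is given, for each receipt and each notification, an encryption coin, a signature and a pseudonym, and a finite table of triples (question, answer, mark). Each test fails if the data do not parse as stated or if there is not exactly one item of data for each ciphertext that the test examines one by one. - $testUR$: for every receipt $j$, the disclosed signature $s_j$ is a signature of $A$ on some $(q_j,a_j,i_j)$, where $i_j$ is the pseudonym of some post that carries a valid mixnet signature for role $C$, and the receipt equals $enc(((q_j,a_j,i_j),s_j),i_j,coin_j)$. - $testUMC$: $e$ carries a valid mixnet signature for role $E$, and every disclosed evaluation is signed by the examiner and contains some $(q,a)$ and $m$ with $(q,a,m)$ in the table. - $testUTI$: there are as many receipts as notifications, and for each $j$ receipt $j$ and notification $j$ are re-obtained by encrypting the disclosed signed contents with the disclosed coins and pseudonyms, the two pseudonyms of encryption, the pseudonym in the accepted test and the one in the marked test are all equal, questions and answers are equal, and $A$'s signature in the marked test is the one in the receipt (respectively, in the format with designated examiner, is a signature of $A$ on $b$). - $testUTM$: every notification passes the single-entry check of $testUTI$ together with some receipt. - $testUMI$: every notification equals $enc((M,s),i,coin)$,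 where $s$ is the disclosed signature, valid for $e$, on the marked test $M$, and $i$ is the pseudonym in $M$. An execution is *honest* if there is no attacker, no principal is corrupted, the examiner's post has role $E$, and the disclosed data are those of an *honest authority*: the coins, signatures and pseudonyms are the ones used in the ciphertexts on the board, and the table has only entries $(q,a,Correct(q,a))$ and has an entry for each accepted test. **Theorem.** For every number of registered candidates, accepted tests and marked tests, all five tests are sound and complete: 1. (Registration) If the mixnet is not corrupted, with all other principals possibly corrupted and arbitrary disclosed data, then $testUR=true$ implies $\{i:(i,x)\in Accepted\}\subseteq I_r$. In every honest execution this inclusion implies $testUR=true$. 2. (Marking Correctness) If the exam authority is not corrupted and the disclosed data are those of an honest authority, then $testUMC=true$ implies $Correct(x)=m$ for all $(i,x,m)\in Marked$. In every honest execution this property implies $testUMC=true$. 3. (Test Integrity) For arbitrary corrupted principals and disclosed data, $testUTI=true$ implies $Accepted=\{(i,x):(i,x,m)\in Marked\}$. In every honest execution in which the tests are marked in the order in which they were accepted (the sequence of pseudonyms of the notifications is a subsequence of that of the receipts), this equality implies $testUTI=true$. 4. (Test Markedness) For arbitrary corrupted principals and disclosed data, $testUTM=true$ implies $\{(i,x):(i,x,m)\in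 Marked\}\subseteq Accepted$. In every honest execution this inclusion implies $testUTM=true$. 5. (Mark Integrity) For arbitrary corrupted principals and disclosed data, $testUMI=true$ implies $Assigned=\{(i,m):(i,x,m)\in Marked\}$. In every honest execution this equality implies $testUMI=true$. Moreover, in every honest execution in which the tests are marked in the order of acceptance, all accepted tests are marked, and all marks are correct, all five tests return true. -/

import Mathlib

namespace Remark

/-! # Symbolic messages -/

/-- The two roles for which the mixnet issues pseudonyms: candidates and examiners. -/
inductive Role
  | C
  | E
  deriving DecidableEq

/-- The principals: the mixnet, the exam authority, and unboundedly many candidates and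
examiners. -/
inductive Principal
  | net
  | ea
  | cand (n : ℕ)
  | exr (n : ℕ)
  deriving DecidableEq

/-- Messages: the free term algebra over the constructors of the protocol.  `atom`s are the
names used as questions, answers, marks and encryption coins, `sk P` is the long-term private
key of `P`, and `expo R` is the secret exponent of the mixnet for the role `R`.  The destructors
`decrypt`, `checkSign` and `checkPseudo` below are the rewrite rules of the equational theory.
As in the process model, one public key `pk k` serves for encryption and for signatures. -/
inductive Term
  | atom (n : ℕ)
  | role (R : Role)
  | sk (P : Principal)
  | expo (R : Role)
  | pk (k : Term)
  | exp (x : Term)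
  | pseudoPub (p x : Term)
  | pseudoPriv (k h : Term)
  | sign (m k : Term)
  | enc (m p r : Term)
  | pair (a b : Term)
  | triple (a b c : Term)
  | quad (a b c d : Term)
  deriving DecidableEq

open Term

/-- `decrypt (encrypt (m, pk k, r), k) = m` and
`decrypt (encrypt (m, pseudo_pub (pk k, x), r), pseudo_priv (k, exp x)) = m`. -/
def decrypt : Term → Term → Option Term
  | enc m p _, k =>
    if p = pk k then some m
    else match k with
      | pseudoPriv k' (exp x) => if p = pseudoPub (pk k') x then some m else none
      | _ => none
  | _, _ => none

/-- `checksign (sign (m, k), pk k) = m` and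
`checksign (sign (m, pseudo_priv (k, exp x)), pseudo_pub (pk k, x)) = m`. -/
def checkSign : Term → Term → Option Term
  | sign m k, w =>
    if w = pk k then some m
    else match k with
      | pseudoPriv k' (exp x) => if w = pseudoPub (pk k') x then some m else none
      | _ => none
  | _, _ => none

/-- `checkpseudo (pseudo_pub (pk k, x), pseudo_priv (k, exp x)) = true`. -/
def checkPseudo : Term → Term → Bool
  | pseudoPub (pk k) x, pseudoPriv k' (exp x') => k = k' && x = x'
  | _, _ => false

/-- What an attacker can compute from a set of messages: apply every constructor and every
destructor.  The atoms and the role constants are known to everybody. -/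
inductive Derives (K : Set Term) : Term → Prop
  | known {t} : t ∈ K → Derives K t
  | atom (n) : Derives K (atom n)
  | role (R) : Derives K (role R)
  | pk {k} : Derives K k → Derives K (pk k)
  | exp {x} : Derives K x → Derives K (exp x)
  | pseudoPub {p x} : Derives K p → Derives K x → Derives K (pseudoPub p x)
  | pseudoPriv {k h} : Derives K k → Derives K h → Derives K (pseudoPriv k h)
  | sign {m k} : Derives K m → Derives K k → Derives K (sign m k)
  | enc {m p r} : Derives K m → Derives K p → Derives K r → Derives K (enc m p r)
  | pair {a b} : Derives K a → Derives K b → Derives K (pair a b)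
  | triple {a b c} : Derives K a → Derives K b → Derives K c → Derives K (triple a b c)
  | quad {a b c d} : Derives K a → Derives K b → Derives K c → Derives K d →
      Derives K (quad a b c d)
  | pair₁ {a b} : Derives K (.pair a b) → Derives K a
  | pair₂ {a b} : Derives K (.pair a b) → Derives K b
  | triple₁ {a b c} : Derives K (.triple a b c) → Derives K a
  | triple₂ {a b c} : Derives K (.triple a b c) → Derives K b
  | triple₃ {a b c} : Derives K (.triple a b c) → Derives K c
  | quad₁ {a b c d} : Derives K (.quad a b c d) → Derives K a
  | quad₂ {a b c d} : Derives K (.quad a b c d) → Derives K b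
  | quad₃ {a b c d} : Derives K (.quad a b c d) → Derives K c
  | quad₄ {a b c d} : Derives K (.quad a b c d) → Derives K d
  | getmess {m k} : Derives K (.sign m k) → Derives K m
  | decrypt {t k m} : Derives K t → Derives K k → decrypt t k = some m → Derives K m

/-! # The protocol -/

/-- Private and public keys of the exam authority and of the mixnet. -/
abbrev skA : Term := sk .ea
abbrev skN : Term := sk .net
abbrev pkA : Term := pk skA
abbrev pkN : Term := pk skN

/-- A post in the pseudonym section `bbn` of the bulletin board:
pseudonym, generator, role, and a signature meant to be that of the mixnet. -/
structure PseudoPost where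
  pseudonym : Term
  generator : Term
  role : Term
  sig : Term
  deriving DecidableEq

/-- The check `(pseudo, h, r) = checksign (sig, pkN) && r = R`. -/
def PseudoPost.signedFor (p : PseudoPost) (pkN : Term) (R : Role) : Bool :=
  checkSign p.sig pkN = some (triple p.pseudonym p.generator p.role) && p.role = Term.role R

/-- The post that the mixnet makes for the public key `k` registered with role `R`. -/
def netPost (R : Role) (k : Term) : PseudoPost where
  pseudonym := pseudoPub k (expo R)
  generator := exp (expo R)
  role := Term.role R
  sig := sign (triple (pseudoPub k (expo R)) (exp (expo R)) (Term.role R)) skN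

/-- The four kinds of posts in the section `bba` of the exam authority. -/
inductive Kind
  | question
  | receipt
  | distribution
  | notification
  deriving DecidableEq

/-- Events of an execution: enrolment of a public key for a role, a post of the mixnet in `bbn`,
a post of the attacker in `bbn`, a post in `bba`, a message on the public network. -/
inductive Event
  | enrol (R : Role) (k : Term)
  | mixnet (p : PseudoPost)
  | forged (p : PseudoPost)
  | bba (k : Kind) (t : Term)
  | send (t : Term)

/-- All posts in the pseudonym section of the board (the latest post first). -/
def bbn (tr : List Event) : List PseudoPost :=
  tr.filterMap fun
    | .mixnet p => some p
    | .forged p => some p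
    | _ => none

/-- All posts of a given kind in the section of the exam authority (the latest post first). -/
def bba (k : Kind) (tr : List Event) : List Term :=
  tr.filterMap fun
    | .bba k' t => if k' = k then some t else none
    | _ => none

/-- The key under which a ciphertext is encrypted. -/
def recipient : Term → Option Term
  | enc _ p _ => some p
  | _ => none

/-- The two message formats of the test that the exam authority signs for marking: the plain
test `(q, a, i)`, as in the verifiability-tests, or the test together with the pseudonym
of the designated examiner, `(q, a, i, e)`, as in the processes of the protocol. -/
inductive Format
  | plain
  | designated
  deriving DecidableEq

/-- The test signed by the exam authority for marking by the examiner with pseudonym `e`. -/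
def testBody : Format → (q a i e : Term) → Term
  | .plain, q, a, i, _ => triple q a i
  | .designated, q, a, i, e => quad q a i e

/-- Pattern matching on `testBody`: returns question, answer, candidate pseudonym. -/
def readBody : Format → (e body : Term) → Option (Term × Term × Term)
  | .plain, _, triple q a i => some (q, a, i)
  | .designated, e, quad q a i e' => if e' = e then some (q, a, i) else none
  | _, _, _ => none

/-- Who is the attacker: whether there is an active one, and which principals are corrupted,
that is, reveal their private keys to the attacker, who then acts in their name. -/
structure Threat where
  active : Prop
  corrupt : Set Principal

/-- The knowledge of the attacker: all public keys, the private keys of the corrupted principals,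
and everything that is posted or sent. -/
inductive Knows (T : Threat) (tr : List Event) : Term → Prop
  | pub (P) : Knows T tr (pk (sk P))
  | priv {P} : P ∈ T.corrupt → Knows T tr (sk P)
  | pseudonym {p} : p ∈ bbn tr → Knows T tr p.pseudonym
  | generator {p} : p ∈ bbn tr → Knows T tr p.generator
  | role {p} : p ∈ bbn tr → Knows T tr p.role
  | sig {p} : p ∈ bbn tr → Knows T tr p.sig
  | post {k t} : Event.bba k t ∈ tr → Knows T tr t
  | sent {t} : Event.send t ∈ tr → Knows T tr t

/-- The messages that the attacker can build. -/
def Attacker (T : Threat) (tr : List Event) (t : Term) : Prop :=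
  Derives {u | Knows T tr u} t

/-- The executions of the protocol (the latest event first) with message format `v`, attacker `T`,
and with `ex` as the post of the examiner to whom the exam authority assigns the tests. -/
inductive Trace (v : Format) (T : Threat) (ex : PseudoPost) : List Event → Prop
  | nil : Trace v T ex []
  /-- Candidates and examiners enrol their public keys. -/
  | enrolC {tr} (n : ℕ) : Trace v T ex tr →
      Trace v T ex (.enrol .C (pk (sk (.cand n))) :: tr)
  | enrolE {tr} (n : ℕ) : Trace v T ex tr →
      Trace v T ex (.enrol .E (pk (sk (.exr n))) :: tr)
  /-- Preparation: the mixnet posts the signed pseudonym of an enrolled key. -/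
  | mix {tr R k} : Trace v T ex tr → .enrol R k ∈ tr →
      Trace v T ex (.mixnet (netPost R k) :: tr)
  /-- Testing: the exam authority posts an encrypted question for a candidate pseudonym. -/
  | question {tr p} (q c : ℕ) : Trace v T ex tr → p ∈ bbn tr → p.signedFor pkN .C →
      Trace v T ex (.bba .question
        (enc (pair (atom q) (sign (atom q) skA)) p.pseudonym (atom c)) :: tr)
  /-- Testing: a candidate answers the question and submits the signed test. -/
  | submit {tr p t q s} (n a c : ℕ) : Trace v T ex tr → p ∈ bbn tr → p.signedFor pkN .C →
      checkPseudo p.pseudonym (pseudoPriv (sk (.cand n)) p.generator) →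
      t ∈ bba .question tr →
      decrypt t (pseudoPriv (sk (.cand n)) p.generator) = some (pair q s) →
      checkSign s pkA = some q →
      Trace v T ex (.send
        (enc (pair (triple q (atom a) p.pseudonym)
          (sign (triple q (atom a) p.pseudonym) (pseudoPriv (sk (.cand n)) p.generator)))
          pkA (atom c)) :: tr)
  /-- Testing: the exam authority collects a test and posts the receipt, at most one for each
  pseudonym. -/
  | collect {tr p r t q a s} (c : ℕ) : Trace v T ex tr → p ∈ bbn tr → p.signedFor pkN .C →
      enc (pair q (sign q skA)) p.pseudonym r ∈ bba .question tr →
      .send t ∈ tr → decrypt t skA = some (pair (triple q a p.pseudonym) s) →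
      checkSign s p.pseudonym = some (triple q a p.pseudonym) →
      (∀ u ∈ bba .receipt tr, recipient u ≠ some p.pseudonym) →
      Trace v T ex (.bba .receipt
        (enc (pair (triple q a p.pseudonym) (sign (triple q a p.pseudonym) skA))
          p.pseudonym (atom c)) :: tr)
  /-- Marking: the exam authority assigns a collected test to the examiner. -/
  | distribute {tr r q a i} (c : ℕ) : Trace v T ex tr → ex ∈ bbn tr → ex.signedFor pkN .E →
      enc (pair (triple q a i) (sign (triple q a i) skA)) i r ∈ bba .receipt tr →
      Trace v T ex (.bba .distribution
        (enc (pair (testBody v q a i ex.pseudonym) (sign (testBody v q a i ex.pseudonym) skA))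
          ex.pseudonym (atom c)) :: tr)
  /-- Marking: an examiner marks a test and sends the signed evaluation to the authority. -/
  | mark {tr p t q a i s} (n m c : ℕ) : Trace v T ex tr → p ∈ bbn tr → p.signedFor pkN .E →
      checkPseudo p.pseudonym (pseudoPriv (sk (.exr n)) p.generator) →
      t ∈ bba .distribution tr →
      decrypt t (pseudoPriv (sk (.exr n)) p.generator) =
        some (pair (testBody v q a i p.pseudonym) s) →
      checkSign s pkA = some (testBody v q a i p.pseudonym) →
      Trace v T ex (.send
        (enc (pair (triple (testBody v q a i p.pseudonym) s (atom m))
          (sign (triple (testBody v q a i p.pseudonym) s (atom m))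
            (pseudoPriv (sk (.exr n)) p.generator)))
          pkA (atom c)) :: tr)
  /-- Notification: the exam authority posts a received evaluation of a test that it has assigned,
  encrypted under the pseudonym of the candidate, at most one for each pseudonym. -/
  | notify {tr r t q a i m s} (c : ℕ) : Trace v T ex tr →
      enc (pair (testBody v q a i ex.pseudonym) (sign (testBody v q a i ex.pseudonym) skA))
        ex.pseudonym r ∈ bba .distribution tr →
      .send t ∈ tr →
      decrypt t skA = some (pair (triple (testBody v q a i ex.pseudonym)
        (sign (testBody v q a i ex.pseudonym) skA) m) s) →
      checkSign s ex.pseudonym = some (triple (testBody v q a i ex.pseudonym)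
        (sign (testBody v q a i ex.pseudonym) skA) m) →
      (∀ u ∈ bba .notification tr, recipient u ≠ some i) →
      Trace v T ex (.bba .notification
        (enc (pair (triple (testBody v q a i ex.pseudonym)
          (sign (testBody v q a i ex.pseudonym) skA) m) s) i (atom c)) :: tr)
  /-- Notification: the mixnet reveals the secret exponent of the candidates to the authority. -/
  | reveal {tr} (c : ℕ) : Trace v T ex tr →
      Trace v T ex (.send (enc (pair (expo .C) (sign (expo .C) skN)) pkA (atom c)) :: tr)
  /-- The attacker sends a message on the network. -/
  | fake {tr t} : Trace v T ex tr → T.active → Attacker T tr t → Trace v T ex (.send t :: tr)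
  /-- The attacker posts in the pseudonym section of the board. -/
  | forge {tr} {p : PseudoPost} : Trace v T ex tr → T.active →
      Attacker T tr p.pseudonym → Attacker T tr p.generator → Attacker T tr p.role →
      Attacker T tr p.sig → Trace v T ex (.forged p :: tr)
  /-- The attacker posts in the name of a corrupted exam authority. -/
  | corruptEA {tr t} (k : Kind) : Trace v T ex tr → T.active → .ea ∈ T.corrupt →
      Attacker T tr t → Trace v T ex (.bba k t :: tr)

/-! # The abstract model of exams and the five requirements -/

/-- An exam in the abstract model, with identities, questions, answers and marks in the types
`I`, `Q`, `A`, `M`. -/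
structure Exam (I Q A M : Type) where
  /-- the registered candidates -/
  Ir : Set I
  Accepted : Set (I × (Q × A))
  Marked : Set (I × (Q × A) × M)
  Assigned : Set (I × M)
  Correct : Q × A → M

namespace Exam

variable {I Q A M : Type} (X : Exam I Q A M)

/-- All accepted tests are submitted by registered candidates. -/
def Registration : Prop := {i | ∃ x, (i, x) ∈ X.Accepted} ⊆ X.Ir

/-- All marks are computed correctly. -/
def MarkingCorrectness : Prop := ∀ i x m, (i, x, m) ∈ X.Marked → X.Correct x = m

/-- All and only the accepted tests are marked. -/
def TestIntegrity : Prop := X.Accepted = {y | ∃ m, (y.1, y.2, m) ∈ X.Marked}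

/-- Only accepted tests are marked. -/
def TestMarkedness : Prop := {y | ∃ m, (y.1, y.2, m) ∈ X.Marked} ⊆ X.Accepted

/-- All and only the marks given to the tests are assigned to the corresponding candidates. -/
def MarkIntegrity : Prop := X.Assigned = {y | ∃ x, (y.1, x, y.2) ∈ X.Marked}

end Exam

/-! # The verifiability-tests of the auditor -/

/-- What the exam authority discloses about a ciphertext `enc (pair _ sig) pseudonym coin` on the
board: the coin, the signature inside, and the pseudonym under which it is encrypted. -/
structure Opening where
  coin : Term
  sig : Term
  pseudonym : Term

/-- `f a₁ b₁ && … && f aₙ bₙ`, for lists of the same length (and `false` otherwise). -/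
def all₂ {α β : Type} (f : α → β → Bool) : List α → List β → Bool
  | [], [] => true
  | a :: as, b :: bs => f a b && all₂ f as bs
  | _, _ => false

/-- The Registration test: each receipt, once re-encrypted from the disclosed data, contains a test
signed by the exam authority, whose pseudonym is one of those signed by the mixnet. -/
def testUR (pkN pkA : Term) (posts : List PseudoPost) (receipts : List Term)
    (data : List Opening) : Bool :=
  all₂ (fun receipt d =>
    match checkSign d.sig pkA with
    | some (triple q a i') =>
      posts.any fun p => p.signedFor pkN .C && p.pseudonym = i' &&
        receipt = enc (pair (triple q a i') d.sig) p.pseudonym d.coin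
    | _ => false) receipts data

/-- The Marking Correctness test: the examiner's pseudonym is signed by the mixnet, and each
disclosed evaluation signed by the examiner agrees with an entry of the table `correct_ans`. -/
def testUMC (v : Format) (pkN : Term) (ex : PseudoPost) (table : List (Term × Term × Term))
    (evals : List Term) : Bool :=
  ex.signedFor pkN .E && evals.all fun sma =>
    match checkSign sma ex.pseudonym with
    | some (triple body _ m) =>
      match readBody v ex.pseudonym body with
      | some (q, a, _) => table.any fun y => y.2.2 = m && q = y.1 && y.2.1 = a
      | none => false
    | _ => false

/-- The signature `sca'` of the exam authority in a marked test belongs to the accepted test with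
receipt signature `sca`: it is the same signature if both sign the plain test; in the other format
it is the authority's signature on the marked test. -/
def matchSig (pkA : Term) : Format → (sca body sca' : Term) → Bool
  | .plain, sca, _, sca' => sca' = sca
  | .designated, _, body, sca' => checkSign sca' pkA = some body

/-- The Test Integrity test for one receipt and one notification. -/
def entryUTI (v : Format) (pkA : Term) (ex : PseudoPost) (receipt notif : Term)
    (d e : Opening) : Bool :=
  match checkSign d.sig pkA, checkSign e.sig ex.pseudonym with
  | some (triple q a i'), some (triple body sca' m) =>
    match readBody v ex.pseudonym body with
    | some (q', a', i'') =>
      (receipt = enc (pair (triple q a i') d.sig) d.pseudonym d.coin &&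
        notif = enc (pair (triple body sca' m) e.sig) e.pseudonym e.coin &&
        matchSig pkA v d.sig body sca') &&
      (d.pseudonym = e.pseudonym && e.pseudonym = i' && i' = i'' && q = q' && a = a')
    | none => false
  | _, _ => false

/-- The Test Integrity test: there are as many receipts as notifications, and the `j`-th receipt
agrees with the `j`-th notification. -/
def testUTI (v : Format) (pkA : Term) (ex : PseudoPost) (receipts notifs : List Term)
    (data data' : List Opening) : Bool :=
  receipts.length = notifs.length &&
    all₂ (fun t d => entryUTI v pkA ex t.1 t.2 d.1 d.2) (receipts.zip notifs) (data.zip data')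

/-- The Test Markedness test: each notification agrees with some receipt. -/
def testUTM (v : Format) (pkA : Term) (ex : PseudoPost) (receipts notifs : List Term)
    (data data' : List Opening) : Bool :=
  all₂ (fun notif e =>
    (receipts.zip data).any fun y => entryUTI v pkA ex y.1 notif y.2 e) notifs data'

/-- The Mark Integrity test: each notification is the encryption of the marked test signed by the
examiner, under the pseudonym in that test. -/
def testUMI (v : Format) (ex : PseudoPost) (notifs : List Term) (data' : List Opening) : Bool :=
  all₂ (fun notif e =>
    match checkSign e.sig ex.pseudonym with
    | some (triple body sca' m) =>
      match readBody v ex.pseudonym body with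
      | some (_, _, i) => notif = enc (pair (triple body sca' m) e.sig) i e.coin
      | none => false
    | _ => false) notifs data'

/-! # Exam executions with the data given to the auditor -/

/-- An exam execution: a trace of the protocol, the post of the examiner, the marking function,
and the data that the auditor gets after the exam (one opening for each receipt and for each
notification, and the table of evaluations). Nothing is assumed about these data. -/
structure Execution where
  format : Format
  threat : Threat
  examiner : PseudoPost
  trace : List Event
  valid : Trace format threat examiner trace
  examiner_mem : examiner ∈ bbn trace
  correct : Term × Term → Term
  receiptData : List Opening
  notifData : List Opening
  table : List (Term × Term × Term)

namespace Execution

variable (E : Execution)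

def posts : List PseudoPost := bbn E.trace
def receipts : List Term := bba .receipt E.trace
def notifs : List Term := bba .notification E.trace

/-- The exam of an execution. Its relations consist of what the posts of the exam authority contain:
* `(i, (q, a))` is accepted if a receipt is encrypted under `i` and contains a signature of the exam
  authority on `(q, a, i)`;
* `(i, (q, a), m)` is marked if a notification contains a signature of the examiner on the test
  `(q, a)` of `i` with the mark `m`;
* `(i, m)` is assigned if a notification with the mark `m` is encrypted under `i`.
Identities of candidates are their pseudonyms; registered are those issued by the mixnet. -/
def exam : Exam Term Term Term Term where
  Ir := {i | ∃ p, Event.mixnet p ∈ E.trace ∧ p.role = Term.role .C ∧ p.pseudonym = i}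
  Accepted := {y | ∃ ca sca r, enc (pair ca sca) y.1 r ∈ E.receipts ∧
    checkSign sca pkA = some (triple y.2.1 y.2.2 y.1)}
  Marked := {y | ∃ ma sma p r body sca, enc (pair ma sma) p r ∈ E.notifs ∧
    checkSign sma E.examiner.pseudonym = some (triple body sca y.2.2) ∧
    readBody E.format E.examiner.pseudonym body = some (y.2.1.1, y.2.1.2, y.1)}
  Assigned := {y | ∃ body sca sma r, enc (pair (triple body sca y.2) sma) y.1 r ∈ E.notifs}
  Correct := E.correct

def testUR : Bool := Remark.testUR pkN pkA E.posts E.receipts E.receiptData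
def testUMC : Bool :=
  Remark.testUMC E.format pkN E.examiner E.table (E.notifData.map Opening.sig)
def testUTI : Bool :=
  Remark.testUTI E.format pkA E.examiner E.receipts E.notifs E.receiptData E.notifData
def testUTM : Bool :=
  Remark.testUTM E.format pkA E.examiner E.receipts E.notifs E.receiptData E.notifData
def testUMI : Bool := Remark.testUMI E.format E.examiner E.notifs E.notifData

/-- The auditor gets the data from an honest exam authority: the openings are those of the
ciphertexts on the board, and the table has only correct entries and covers the accepted tests. -/
def HonestData : Prop :=
  List.Forall₂ (fun t d => ∃ m, t = enc (pair m d.sig) d.pseudonym d.coin)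
    E.receipts E.receiptData ∧
  List.Forall₂ (fun t d => ∃ m, t = enc (pair m d.sig) d.pseudonym d.coin)
    E.notifs E.notifData ∧
  (∀ y ∈ E.table, E.correct (y.1, y.2.1) = y.2.2) ∧
  (∀ i q a, (i, (q, a)) ∈ E.exam.Accepted → ∃ m, (q, a, m) ∈ E.table)

/-- All principals follow the protocol, no attacker interferes, and the auditor gets correct data. -/
def Honest : Prop :=
  ¬ E.threat.active ∧ E.threat.corrupt = ∅ ∧ E.examiner.role = Term.role .E ∧ E.HonestData

/-- The tests are marked in the same order as they were accepted. -/
def SameOrder : Prop := (E.notifs.map recipient).Sublist (E.receipts.map recipient)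

end Execution

end Remark

namespace Remark

open Term

/-! # Board contents and elementary facts about the tests -/

/-! Soundness rests on the freeness of the term algebra. If disclosed data re-encrypt to a posted
ciphertext, injectivity of `enc` and `pair` makes them its actual components, so every check on the
data is a fact about the board. Test Integrity, Markedness and Mark Integrity follow from this
alone, whoever produced the trace (`entryUTI_iff`, `entryUMI_iff`). `testUMC` re-encrypts nothing;
there honest openings supply the link to the board.

Registration also needs unforgeability of the mixnet's signatures. The invariant `NetSafe` says that
the mixnet's key never leaks and that it signs only what the mixnet signed; derivation preserves it
(`NetSafe.of_derives`), and so does every protocol step (`Trace.netSafe`).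

For completeness, a board without attacker has only ciphertexts of the protocol's shape, and each
notification goes back to a receipt for the same test (`Trace.notification_of_not_active`). For
`testUTI` the two lists must also match position by position: receipts have distinct recipients, so
if all of them are notified in order, the two lists of recipients coincide (`recipients_eq`). -/

theorem mem_bba {k : Kind} {t : Term} {tr : List Event} :
    t ∈ bba k tr ↔ Event.bba k t ∈ tr := by
  unfold bba
  rw [List.mem_filterMap]
  constructor
  · rintro ⟨e, he, h⟩
    cases e <;> grind
  · intro h
    exact ⟨_, h, by simp⟩

theorem mem_bbn {p : PseudoPost} {tr : List Event} :
    p ∈ bbn tr ↔ Event.mixnet p ∈ tr ∨ Event.forged p ∈ tr := by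
  unfold bbn
  rw [List.mem_filterMap]
  constructor
  · rintro ⟨e, he, h⟩
    cases e <;> grind
  · rintro (h | h) <;> exact ⟨_, h, rfl⟩

theorem mem_bbn_cons {p : PseudoPost} {e : Event} {tr : List Event} (h : p ∈ bbn tr) :
    p ∈ bbn (e :: tr) := by
  rw [mem_bbn] at *
  exact h.imp (List.mem_cons_of_mem _) (List.mem_cons_of_mem _)

theorem mem_bba_cons {k : Kind} {t : Term} {e : Event} {tr : List Event} (h : t ∈ bba k tr) :
    t ∈ bba k (e :: tr) := by
  rw [mem_bba] at *
  exact List.mem_cons_of_mem _ h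

/-! ### Entrywise comparison of lists. -/

theorem all₂_iff {α β : Type} (f : α → β → Bool) (l : List α) (l' : List β) :
    all₂ f l l' = true ↔ List.Forall₂ (fun a b => f a b = true) l l' := by
  induction l generalizing l' with
  | nil => cases l' <;> simp [all₂]
  | cons a l ih => cases l' <;> simp [all₂, ih]

/-- Finds the opening of a given ciphertext. Membership in the zip is kept because `testUTM`
searches pairs of receipts and openings, and `testUMC` searches the openings themselves. -/
theorem Forall₂_exists_right {α β : Type} {R : α → β → Prop} {l : List α} {l' : List β}
    (h : List.Forall₂ R l l') {a : α} (ha : a ∈ l) : ∃ b, (a, b) ∈ l.zip l' ∧ R a b := by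
  induction h with
  | nil => simp at ha
  | cons hR _ ih =>
    rcases List.mem_cons.1 ha with rfl | ha
    · exact ⟨_, by simp, hR⟩
    · obtain ⟨b, hb, hR⟩ := ih ha
      exact ⟨b, by simp [hb], hR⟩

theorem Forall₂_mem_zip {α β : Type} {R : α → β → Prop} {l : List α} {l' : List β}
    (h : List.Forall₂ R l l') {a : α} {b : β} (hab : (a, b) ∈ l.zip l') : R a b :=
  (List.forall₂_iff_zip.1 h).2 hab

theorem Forall₂_of_mem_zip {α β : Type} {R S : α → β → Prop} {l : List α} {l' : List β}
    (h : List.Forall₂ R l l') (hS : ∀ a b, a ∈ l → R a b → S a b) : List.Forall₂ S l l' :=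
  List.forall₂_iff_zip.2 ⟨h.length_eq, fun hab =>
    hS _ _ (List.of_mem_zip hab).1 (Forall₂_mem_zip h hab)⟩

/-! ### Signatures, test formats and the checks on single entries. -/

@[simp] theorem checkSign_sign_pk (m k : Term) : checkSign (sign m k) (pk k) = some m := by
  simp [checkSign]

theorem checkSign_pk_iff {s m k : Term} : checkSign s (pk k) = some m ↔ s = sign m k := by
  constructor
  · intro h
    unfold checkSign at h
    split at h
    · rename_i m' k'
      by_cases hk : pk k = pk k'
      · rw [if_pos hk] at h
        injection hk with hk
        injection h with h
        rw [hk, h]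
      · rw [if_neg hk] at h
        -- The second rewrite rule verifies only against a `pseudoPub` term, never against a `pk`
        -- term.
        split at h <;> simp at h
    · simp at h
  · rintro rfl
    simp

theorem readBody_testBody (v : Format) (q a i e : Term) :
    readBody v e (testBody v q a i e) = some (q, a, i) := by
  cases v <;> simp [readBody, testBody]

theorem testBody_inj {v : Format} {q a i e q' a' i' : Term}
    (h : testBody v q a i e = testBody v q' a' i' e) : q = q' ∧ a = a' ∧ i = i' := by
  cases v <;> simp_all [testBody]

theorem signedFor_iff {p : PseudoPost} {R : Role} :
    p.signedFor pkN R = true ↔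
      p.sig = sign (triple p.pseudonym p.generator p.role) skN ∧ p.role = Term.role R := by
  simp [PseudoPost.signedFor, pkN, checkSign_pk_iff]

/-- All equalities demanded by the check are substituted away: one question, one answer and the
single pseudonym `e.pseudonym` remain. -/
theorem entryUTI_iff {v : Format} {ex : PseudoPost} {receipt notif : Term} {d e : Opening} :
    entryUTI v pkA ex receipt notif d e = true ↔ ∃ q a body sca m,
      checkSign d.sig pkA = some (triple q a e.pseudonym) ∧
      checkSign e.sig ex.pseudonym = some (triple body sca m) ∧
      readBody v ex.pseudonym body = some (q, a, e.pseudonym) ∧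
      receipt = enc (pair (triple q a e.pseudonym) d.sig) e.pseudonym d.coin ∧
      notif = enc (pair (triple body sca m) e.sig) e.pseudonym e.coin ∧
      matchSig pkA v d.sig body sca = true ∧ d.pseudonym = e.pseudonym := by
  constructor
  · intro h
    unfold entryUTI at h
    split at h
    · rename_i q a i' body sca' m h1 h2
      split at h
      · rename_i q' a' i'' h3
        simp only [Bool.and_eq_true, decide_eq_true_eq] at h
        obtain ⟨⟨⟨hr, hn⟩, hm⟩, ⟨⟨⟨hd, he⟩, hi⟩, hq⟩, ha⟩ := h
        subst hi hq ha
        subst he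
        exact ⟨q, a, body, sca', m, h1, h2, h3, hd ▸ hr, hn, hm, hd⟩
      · simp at h
    · simp at h
  · rintro ⟨q, a, body, sca, m, h1, h2, h3, h4, h5, h6, h7⟩
    unfold entryUTI
    rw [h1, h2]
    simp only [h3]
    simp [h4, h5, h6, h7]

/-- The left side is the anonymous function inside `testUMI`, spelled out. -/
theorem entryUMI_iff {v : Format} {ex : PseudoPost} {notif : Term} {e : Opening} :
    (match checkSign e.sig ex.pseudonym with
      | some (triple body sca' m) =>
        match readBody v ex.pseudonym body with
        | some (_, _, i) => decide (notif = enc (pair (triple body sca' m) e.sig) i e.coin)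
        | none => false
      | _ => false) = true ↔ ∃ body sca m q a i,
      checkSign e.sig ex.pseudonym = some (triple body sca m) ∧
      readBody v ex.pseudonym body = some (q, a, i) ∧
      notif = enc (pair (triple body sca m) e.sig) i e.coin := by
  constructor
  · intro h
    split at h
    · rename_i body sca m h1
      split at h
      · rename_i q a i h2
        exact ⟨body, sca, m, q, a, i, h1, h2, by simpa using h⟩
      · simp at h
    · simp at h
  · rintro ⟨body, sca, m, q, a, i, h1, h2, h3⟩
    rw [h1]
    simp only [h2]
    simpa using h3

/-! # Unforgeability of the signatures of an uncorrupted mixnet -/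

/-- The term does not give away the private key of the mixnet, and everything in it that is signed
with this key belongs to `S`. -/
def NetSafe (S : Set Term) : Term → Prop
  | atom _ => True
  | Term.role _ => True
  | sk P => P ≠ .net
  | expo _ => True
  | pk k => k = skN ∨ NetSafe S k
  | Term.exp x => NetSafe S x
  | pseudoPub p x => NetSafe S p ∧ NetSafe S x
  | pseudoPriv k h => NetSafe S k ∧ NetSafe S h
  | sign m k => NetSafe S m ∧ (k = skN ∧ m ∈ S ∨ NetSafe S k)
  | enc m p r => NetSafe S m ∧ NetSafe S p ∧ NetSafe S r
  | pair a b => NetSafe S a ∧ NetSafe S b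
  | triple a b c => NetSafe S a ∧ NetSafe S b ∧ NetSafe S c
  | quad a b c d => NetSafe S a ∧ NetSafe S b ∧ NetSafe S c ∧ NetSafe S d

/-- `NetSafe` requires the plaintext of a ciphertext to be safe whatever the encryption key, so the
argument needs no secrecy of decryption keys. -/
theorem NetSafe.of_decrypt {S : Set Term} {t k m : Term} (ht : NetSafe S t)
    (h : decrypt t k = some m) : NetSafe S m := by
  unfold Remark.decrypt at h
  split at h
  · have : NetSafe S _ := ht.1
    split_ifs at h
    · simp_all
    · split at h
      · split_ifs at h
        simp_all
      · simp at h
  · simp at h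

/-- Destructors return subterms that are required to be safe; the exempted occurrences of `skN`,
under `pk` and as a signing key, cannot be extracted. A signature built by the attacker uses a
derivable, hence safe, key, which cannot be `skN`. -/
theorem NetSafe.of_derives {S K : Set Term} (hK : ∀ t ∈ K, NetSafe S t) {t : Term}
    (h : Derives K t) : NetSafe S t := by
  induction h with
  | known h => exact hK _ h
  | decrypt _ _ h ih _ => exact ih.of_decrypt h
  | _ => simp_all [NetSafe]

/-- The messages that the mixnet signs in an execution. -/
def netSigned (tr : List Event) : Set Term :=
  {m | m = expo .C ∨ ∃ p, Event.mixnet p ∈ tr ∧ m = triple p.pseudonym p.generator p.role}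

/-- All terms of an event are `NetSafe`. -/
def Event.NetSafe (S : Set Term) : Event → Prop
  | .enrol _ k => Remark.NetSafe S k
  | .mixnet p => Remark.NetSafe S p.pseudonym ∧ Remark.NetSafe S p.generator ∧
      Remark.NetSafe S p.role ∧ Remark.NetSafe S p.sig
  | .forged p => Remark.NetSafe S p.pseudonym ∧ Remark.NetSafe S p.generator ∧
      Remark.NetSafe S p.role ∧ Remark.NetSafe S p.sig
  | .bba _ t => Remark.NetSafe S t
  | .send t => Remark.NetSafe S t

theorem netSafe_testBody {v : Format} {S : Set Term} {q a i e : Term} (hq : NetSafe S q)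
    (ha : NetSafe S a) (hi : NetSafe S i) (he : NetSafe S e) :
    NetSafe S (testBody v q a i e) := by
  cases v <;> simp_all [testBody, NetSafe]

theorem netSafe_of_testBody {v : Format} {S : Set Term} {q a i e : Term}
    (h : NetSafe S (testBody v q a i e)) : NetSafe S q ∧ NetSafe S a ∧ NetSafe S i := by
  cases v <;> simp_all [testBody, NetSafe]

theorem netSafe_of_mem_bbn {S : Set Term} {tr : List Event} (h : ∀ e ∈ tr, e.NetSafe S)
    {p : PseudoPost} (hp : p ∈ bbn tr) : NetSafe S p.pseudonym ∧ NetSafe S p.generator ∧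
      NetSafe S p.role ∧ NetSafe S p.sig := by
  rcases mem_bbn.1 hp with hp | hp <;> exact h _ hp

theorem netSafe_of_mem_bba {S : Set Term} {tr : List Event} (h : ∀ e ∈ tr, e.NetSafe S)
    {k : Kind} {t : Term} (ht : t ∈ bba k tr) : NetSafe S t :=
  h _ (mem_bba.1 ht)

theorem netSafe_of_attacker {T : Threat} (hT : Principal.net ∉ T.corrupt) {S : Set Term}
    {tr : List Event} (h : ∀ e ∈ tr, e.NetSafe S) {t : Term} (ht : Attacker T tr t) :
    NetSafe S t := by
  refine NetSafe.of_derives ?_ ht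
  intro u hu
  cases hu with
  | pub P => by_cases hP : P = .net <;> simp [NetSafe, hP]
  | priv hP => exact fun hP' => hT (hP' ▸ hP)
  | pseudonym hp => exact (netSafe_of_mem_bbn h hp).1
  | generator hp => exact (netSafe_of_mem_bbn h hp).2.1
  | role hp => exact (netSafe_of_mem_bbn h hp).2.2.1
  | sig hp => exact (netSafe_of_mem_bbn h hp).2.2.2
  | post ht => exact h _ ht
  | sent ht => exact h _ ht

/-- The set `S` is any superset of the signed messages, fixed while the trace is shortened. Since
`netSigned` grows along the trace, this replaces an argument on the monotonicity of `NetSafe` in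
`S`. -/
theorem Trace.netSafe {v : Format} {T : Threat} {ex : PseudoPost} {tr : List Event}
    (h : Trace v T ex tr) (hT : Principal.net ∉ T.corrupt) {S : Set Term}
    (hS : netSigned tr ⊆ S) : ∀ e ∈ tr, e.NetSafe S := by
  have mono : ∀ (e : Event) (tr : List Event), netSigned tr ⊆ netSigned (e :: tr) := by
    rintro e tr m (h | ⟨p, hp, h⟩)
    · exact Or.inl h
    · exact Or.inr ⟨p, List.mem_cons_of_mem _ hp, h⟩
  have expo_mem : expo .C ∈ S := hS (Or.inl rfl)
  induction h with
  | nil => simp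
  | enrolC n _ ih =>
    refine List.forall_mem_cons.2 ⟨?_, ih ((mono _ _).trans hS)⟩
    simp [Event.NetSafe, NetSafe]
  | enrolE n _ ih =>
    refine List.forall_mem_cons.2 ⟨?_, ih ((mono _ _).trans hS)⟩
    simp [Event.NetSafe, NetSafe]
  | @mix tr R k _ hk ih =>
    have ih := ih ((mono _ _).trans hS)
    refine List.forall_mem_cons.2 ⟨?_, ih⟩
    have hk : NetSafe S k := ih _ hk
    have hm : triple (pseudoPub k (expo R)) (Term.exp (expo R)) (Term.role R) ∈ S :=
      hS (Or.inr ⟨netPost R k, List.mem_cons_self, rfl⟩)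
    simp [Event.NetSafe, NetSafe, netPost, hk, hm]
  | question q c _ hp _ ih =>
    have ih := ih ((mono _ _).trans hS)
    refine List.forall_mem_cons.2 ⟨?_, ih⟩
    have := netSafe_of_mem_bbn ih hp
    simp [Event.NetSafe, NetSafe, this]
  | submit n a c _ hp _ _ ht hd _ ih =>
    have ih := ih ((mono _ _).trans hS)
    refine List.forall_mem_cons.2 ⟨?_, ih⟩
    have hp := netSafe_of_mem_bbn ih hp
    have hd := (netSafe_of_mem_bba ih ht).of_decrypt hd
    simp_all [Event.NetSafe, NetSafe]
  | collect c _ hp _ _ ht hd _ _ ih =>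
    have ih := ih ((mono _ _).trans hS)
    refine List.forall_mem_cons.2 ⟨?_, ih⟩
    have hd := NetSafe.of_decrypt (ih _ ht) hd
    simp_all [Event.NetSafe, NetSafe]
  | distribute c _ hex _ hr ih =>
    have ih := ih ((mono _ _).trans hS)
    refine List.forall_mem_cons.2 ⟨?_, ih⟩
    have hex := (netSafe_of_mem_bbn ih hex).1
    have hr := netSafe_of_mem_bba ih hr
    have hb := netSafe_testBody (v := v) hr.1.1.1 hr.1.1.2.1 hr.1.1.2.2 hex
    simp [Event.NetSafe, NetSafe, hb, hex]
  | mark n m c _ hp _ _ ht hd _ ih =>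
    have ih := ih ((mono _ _).trans hS)
    refine List.forall_mem_cons.2 ⟨?_, ih⟩
    have hp := netSafe_of_mem_bbn ih hp
    have hd := (netSafe_of_mem_bba ih ht).of_decrypt hd
    simp_all [Event.NetSafe, NetSafe]
  | notify c _ _ ht hd _ _ ih =>
    have ih := ih ((mono _ _).trans hS)
    refine List.forall_mem_cons.2 ⟨?_, ih⟩
    have hd := NetSafe.of_decrypt (ih _ ht) hd
    -- The key of the new ciphertext is the pseudonym inside the decrypted test, and is safe as a
    -- part of it.
    have hi := (netSafe_of_testBody hd.1.1).2.2
    exact ⟨hd, hi, trivial⟩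
  | reveal c _ ih =>
    refine List.forall_mem_cons.2 ⟨?_, ih ((mono _ _).trans hS)⟩
    simp [Event.NetSafe, NetSafe, expo_mem]
  | fake _ _ ht ih =>
    have ih := ih ((mono _ _).trans hS)
    exact List.forall_mem_cons.2 ⟨netSafe_of_attacker hT ih ht, ih⟩
  | forge _ _ h1 h2 h3 h4 ih =>
    have ih := ih ((mono _ _).trans hS)
    exact List.forall_mem_cons.2 ⟨⟨netSafe_of_attacker hT ih h1, netSafe_of_attacker hT ih h2,
      netSafe_of_attacker hT ih h3, netSafe_of_attacker hT ih h4⟩, ih⟩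
  | corruptEA k _ _ _ ht ih =>
    have ih := ih ((mono _ _).trans hS)
    exact List.forall_mem_cons.2 ⟨netSafe_of_attacker hT ih ht, ih⟩

/-- If the mixnet is not corrupted, then every pseudonym with its signature was posted by it. -/
theorem Trace.mixnet_of_signedFor {v : Format} {T : Threat} {ex : PseudoPost} {tr : List Event}
    (h : Trace v T ex tr) (hT : Principal.net ∉ T.corrupt) {p : PseudoPost} (hp : p ∈ bbn tr)
    {R : Role} (hR : p.signedFor pkN R = true) :
    ∃ p', Event.mixnet p' ∈ tr ∧ p'.role = Term.role R ∧ p'.pseudonym = p.pseudonym := by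
  obtain ⟨hs, hr⟩ := signedFor_iff.1 hR
  have hsafe := (netSafe_of_mem_bbn (h.netSafe hT subset_rfl) hp).2.2.2
  rw [hs] at hsafe
  -- The signed triple is not the revealed exponent, and `skN` is not safe, so it comes from a post
  -- of the mixnet.
  rcases hsafe.2 with ⟨-, hm | ⟨p', hp', hm⟩⟩ | hk
  · cases hm
  · injection hm with h1 h2 h3
    exact ⟨p', hp', h3 ▸ hr, h1.symm⟩
  · exact absurd rfl hk

/-! # The board after an honest execution -/

section Honest

variable {v : Format} {T : Threat} {ex : PseudoPost} {tr : List Event}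

theorem Trace.bbn_of_not_active (h : Trace v T ex tr) (hT : ¬ T.active) {p : PseudoPost}
    (hp : p ∈ bbn tr) : ∃ R k, p = netPost R k := by
  rw [mem_bbn] at hp
  induction h with
  | nil => simp at hp
  | mix _ _ ih =>
    simp only [List.mem_cons, Event.mixnet.injEq, reduceCtorEq, false_or] at hp
    rcases hp with (rfl | hp) | hp
    · exact ⟨_, _, rfl⟩
    · exact ih (Or.inl hp)
    · exact ih (Or.inr hp)
  | fake _ ha => exact absurd ha hT
  | forge _ ha => exact absurd ha hT
  | corruptEA _ _ ha => exact absurd ha hT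
  | _ => simp_all

theorem Trace.receipt_of_not_active (h : Trace v T ex tr) (hT : ¬ T.active) {t : Term}
    (ht : t ∈ bba .receipt tr) : ∃ p q a r, p ∈ bbn tr ∧ p.signedFor pkN .C = true ∧
      t = enc (pair (triple q a p.pseudonym) (sign (triple q a p.pseudonym) skA))
        p.pseudonym r := by
  rw [mem_bba] at ht
  induction h with
  | nil => simp at ht
  | collect c _ hp hs _ _ _ _ _ ih =>
    rcases List.mem_cons.1 ht with ht | ht
    · injection ht with _ ht
      exact ⟨_, _, _, _, mem_bbn_cons hp, hs, ht⟩
    · obtain ⟨p, q, a, r, hp, h⟩ := ih ht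
      exact ⟨p, q, a, r, mem_bbn_cons hp, h⟩
  | fake _ ha => exact absurd ha hT
  | forge _ ha => exact absurd ha hT
  | corruptEA _ _ ha => exact absurd ha hT
  | _ =>
    rename_i ih
    obtain ⟨p, q, a, r, hp, h⟩ := ih (by simpa using ht)
    exact ⟨p, q, a, r, mem_bbn_cons hp, h⟩

/-- The guard of `collect` against a second receipt for a pseudonym is exactly what the induction
step needs. -/
theorem Trace.nodup_receipt_of_not_active (h : Trace v T ex tr) (hT : ¬ T.active) :
    ((bba .receipt tr).map recipient).Nodup := by
  induction h with
  | nil => simp [bba]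
  | collect c _ _ _ _ _ _ _ hu ih =>
    refine List.nodup_cons.2 ⟨?_, ih⟩
    rintro hm
    obtain ⟨u, hu', h⟩ := List.mem_map.1 hm
    exact hu u hu' h
  | fake _ ha => exact absurd ha hT
  | forge _ ha => exact absurd ha hT
  | corruptEA _ _ ha => exact absurd ha hT
  | _ => assumption

theorem Trace.distribution_of_not_active (h : Trace v T ex tr) (hT : ¬ T.active) {t : Term}
    (ht : t ∈ bba .distribution tr) : ∃ q a i r c,
      enc (pair (triple q a i) (sign (triple q a i) skA)) i r ∈ bba .receipt tr ∧
      t = enc (pair (testBody v q a i ex.pseudonym) (sign (testBody v q a i ex.pseudonym) skA))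
          ex.pseudonym c := by
  rw [mem_bba] at ht
  induction h with
  | nil => simp at ht
  | distribute c _ _ _ hr ih =>
    rcases List.mem_cons.1 ht with ht | ht
    · injection ht with _ ht
      exact ⟨_, _, _, _, _, mem_bba_cons hr, ht⟩
    · obtain ⟨q, a, i, r, c, hp, h⟩ := ih ht
      exact ⟨q, a, i, r, c, mem_bba_cons hp, h⟩
  | fake _ ha => exact absurd ha hT
  | forge _ ha => exact absurd ha hT
  | corruptEA _ _ ha => exact absurd ha hT
  | _ =>
    rename_i ih
    obtain ⟨q, a, i, r, c, hp, h⟩ := ih (by simpa using ht)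
    exact ⟨q, a, i, r, c, mem_bba_cons hp, h⟩

theorem Trace.notification_of_not_active (h : Trace v T ex tr) (hT : ¬ T.active) {t : Term}
    (ht : t ∈ bba .notification tr) : ∃ q a i m s r c,
      enc (pair (triple q a i) (sign (triple q a i) skA)) i r ∈ bba .receipt tr ∧
      checkSign s ex.pseudonym = some (triple (testBody v q a i ex.pseudonym)
        (sign (testBody v q a i ex.pseudonym) skA) m) ∧
      t = enc (pair (triple (testBody v q a i ex.pseudonym)
          (sign (testBody v q a i ex.pseudonym) skA) m) s) i c := by
  rw [mem_bba] at ht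
  induction h with
  | nil => simp at ht
  | notify c htr hd _ _ hs _ ih =>
    rcases List.mem_cons.1 ht with ht | ht
    · injection ht with _ ht
      obtain ⟨q, a, i, r, c, hr, he⟩ := htr.distribution_of_not_active hT hd
      injection he with he
      -- The distributed test equals one built from a receipt with the same examiner, so question,
      -- answer and candidate agree.
      injection he with he
      obtain ⟨rfl, rfl, rfl⟩ := testBody_inj he
      exact ⟨_, _, _, _, _, _, _, mem_bba_cons hr, hs, ht⟩
    · obtain ⟨q, a, i, m, s, r, c, hp, h⟩ := ih ht
      exact ⟨q, a, i, m, s, r, c, mem_bba_cons hp, h⟩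
  | fake _ ha => exact absurd ha hT
  | forge _ ha => exact absurd ha hT
  | corruptEA _ _ ha => exact absurd ha hT
  | _ =>
    rename_i ih
    obtain ⟨q, a, i, m, s, r, c, hp, h⟩ := ih (by simpa using ht)
    exact ⟨q, a, i, m, s, r, c, mem_bba_cons hp, h⟩

end Honest

/-! # Soundness and completeness of the tests -/

namespace Execution

variable {E : Execution}

/-! ### Registration. -/

theorem registration_of_testUR (hnet : Principal.net ∉ E.threat.corrupt)
    (h : E.testUR = true) : E.exam.Registration := by
  rintro i ⟨x, ca, sca, r, hr, -⟩
  obtain ⟨d, -, hd⟩ := Forall₂_exists_right ((all₂_iff _ _ _).1 h) hr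
  split at hd
  · obtain ⟨p, hp, hpd⟩ := List.any_eq_true.1 hd
    simp only [Bool.and_eq_true, decide_eq_true_eq] at hpd
    obtain ⟨⟨hs, -⟩, he⟩ := hpd
    -- `Accepted` takes the identity from the encryption key, and re-encryption under `p.pseudonym`
    -- identifies the two.
    injection he with _ he
    subst he
    exact E.valid.mixnet_of_signedFor hnet hp hs
  · simp at hd

theorem testUR_of_honest (hE : E.Honest) : E.testUR = true := by
  obtain ⟨hT, -, -, hd, -⟩ := hE
  refine (all₂_iff _ _ _).2 (Forall₂_of_mem_zip hd ?_)
  rintro t d ht ⟨m, htd⟩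
  obtain ⟨p, q, a, r, hp, hs, rfl⟩ := E.valid.receipt_of_not_active hT ht
  injection htd with h1 h2 h3
  injection h1 with h1 h4
  rw [← h4, checkSign_sign_pk]
  refine List.any_eq_true.2 ⟨p, hp, ?_⟩
  simp [hs, h3]

/-! ### Marking Correctness. -/

theorem markingCorrectness_of_testUMC (hE : E.HonestData) (h : E.testUMC = true) :
    E.exam.MarkingCorrectness := by
  rintro i ⟨q, a⟩ m ⟨ma, sma, p, r, body, sca, hn, hs, hb⟩
  obtain ⟨-, hd, htab, -⟩ := hE
  obtain ⟨d, hmem, m', he⟩ := Forall₂_exists_right hd hn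
  injection he with he
  injection he with _ he
  subst he
  simp only [Execution.testUMC, Remark.testUMC, Bool.and_eq_true, List.all_eq_true] at h
  have := h.2 d.sig (List.mem_map_of_mem (List.of_mem_zip hmem).2)
  rw [hs] at this
  simp only [hb] at this
  obtain ⟨y, hy, hyd⟩ := List.any_eq_true.1 this
  simp only [Bool.and_eq_true, decide_eq_true_eq] at hyd
  obtain ⟨⟨rfl, rfl⟩, rfl⟩ := hyd
  exact htab y hy

theorem mem_accepted_of_mem_receipts {q a i r : Term}
    (h : enc (pair (triple q a i) (sign (triple q a i) skA)) i r ∈ E.receipts) :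
    (i, (q, a)) ∈ E.exam.Accepted :=
  ⟨_, _, _, h, checkSign_sign_pk _ _⟩

theorem testUMC_of_honest (hE : E.Honest) (h : E.exam.MarkingCorrectness) :
    E.testUMC = true := by
  obtain ⟨hT, -, hex, -, hd, htab, hacc⟩ := hE
  simp only [Execution.testUMC, Remark.testUMC, Bool.and_eq_true, List.all_eq_true]
  constructor
  -- Every post is the mixnet's, hence correctly signed, but possibly for role `C`; the role `E`
  -- comes from honesty.
  · obtain ⟨R, k, hk⟩ := E.valid.bbn_of_not_active hT E.examiner_mem
    refine signedFor_iff.2 ⟨?_, hex⟩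
    rw [hk]
    rfl
  · intro s hs
    obtain ⟨d, hdm, rfl⟩ := List.mem_map.1 hs
    obtain ⟨t, hmem, m', ht⟩ := Forall₂_exists_right hd.flip hdm
    obtain ⟨q, a, i, m, s, r, c, hr, hs, he⟩ :=
      E.valid.notification_of_not_active hT (List.of_mem_zip hmem).2
    have hn := (List.of_mem_zip hmem).2
    rw [ht] at he
    injection he with he
    injection he with _ he
    rw [he, hs]
    simp only [readBody_testBody]
    have hm : E.correct (q, a) = m :=
      h i (q, a) m ⟨_, _, _, _, _, _, ht ▸ hn, he ▸ hs, readBody_testBody _ _ _ _ _⟩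
    -- The table covers accepted tests, so the receipt behind the notification provides an entry.
    -- Its mark and the given mark are both the correct one.
    obtain ⟨m'', hy⟩ := hacc i q a (mem_accepted_of_mem_receipts hr)
    have hm' : E.correct (q, a) = m'' := htab _ hy
    exact List.any_eq_true.2 ⟨_, hy, by simp [← hm, ← hm']⟩

/-! ### Test Integrity and Test Markedness. -/

/-- The notification determines its signature, hence the marked test, and the check exhibits a
receipt for that test. Shared by both soundness proofs. -/
theorem mem_accepted_of_entryUTI {receipt notif : Term} {d e : Opening}
    (hr : receipt ∈ E.receipts)
    (h : entryUTI E.format pkA E.examiner receipt notif d e = true)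
    {ma sma p r body sca q a m i : Term} (hn : notif = enc (pair ma sma) p r)
    (hs : checkSign sma E.examiner.pseudonym = some (triple body sca m))
    (hb : readBody E.format E.examiner.pseudonym body = some (q, a, i)) :
    (i, (q, a)) ∈ E.exam.Accepted := by
  obtain ⟨q', a', body', sca', m', h1, h2, h3, h4, h5, h6, h7⟩ := entryUTI_iff.1 h
  subst hn
  injection h5 with h5
  injection h5 with _ h5
  subst h5
  obtain ⟨rfl, rfl, rfl⟩ : body' = body ∧ sca' = sca ∧ m' = m := by simpa [h2] using hs
  obtain ⟨rfl, rfl, rfl⟩ : q' = q ∧ a' = a ∧ e.pseudonym = i := by simpa [h3] using hb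
  exact ⟨_, _, _, h4 ▸ hr, h1⟩

theorem testMarkedness_of_testUTM (h : E.testUTM = true) : E.exam.TestMarkedness := by
  rintro ⟨i, q, a⟩ ⟨m, ma, sma, p, r, body, sca, hn, hs, hb⟩
  obtain ⟨e, -, he⟩ := Forall₂_exists_right ((all₂_iff _ _ _).1 h) hn
  obtain ⟨y, hy, he⟩ := List.any_eq_true.1 he
  exact mem_accepted_of_entryUTI (List.of_mem_zip hy).1 he rfl hs hb

theorem testIntegrity_of_testUTI (h : E.testUTI = true) : E.exam.TestIntegrity := by
  simp only [Execution.testUTI, Remark.testUTI, Bool.and_eq_true, decide_eq_true_eq,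
    all₂_iff] at h
  obtain ⟨hlen, h⟩ := h
  ext ⟨i, q, a⟩
  constructor
  · rintro ⟨ca, sca, r, hr, hs⟩
    -- Equal lengths guarantee that zipping drops no receipt.
    obtain ⟨n, hn⟩ : ∃ n, (enc (pair ca sca) i r, n) ∈ E.receipts.zip E.notifs := by
      obtain ⟨j, hj, hje⟩ := List.mem_iff_getElem.1 hr
      refine ⟨E.notifs[j]'(hlen ▸ hj), List.mem_iff_getElem.2 ⟨j, by simp; omega, ?_⟩⟩
      simp only [List.getElem_zip, hje]
    obtain ⟨⟨d, e⟩, -, he⟩ := Forall₂_exists_right h hn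
    obtain ⟨q', a', body', sca', m', h1, h2, h3, h4, h5, h6, h7⟩ := entryUTI_iff.1 he
    injection h4 with h4 h8
    injection h4 with _ h4
    subst h4
    obtain ⟨rfl, rfl, h9⟩ : q' = q ∧ a' = a ∧ e.pseudonym = i := by
      simpa [h1] using hs
    simp only at h5
    subst h9
    exact ⟨m', _, _, _, _, _, _, h5 ▸ (List.of_mem_zip hn).2, h2, h3⟩
  · rintro ⟨m, ma, sma, p, r, body, sca, hn, hs, hb⟩
    obtain ⟨t, ht⟩ : ∃ t, (t, enc (pair ma sma) p r) ∈ E.receipts.zip E.notifs := by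
      obtain ⟨j, hj, hje⟩ := List.mem_iff_getElem.1 hn
      refine ⟨E.receipts[j]'(hlen ▸ hj), List.mem_iff_getElem.2 ⟨j, by simp; omega, ?_⟩⟩
      simp only [List.getElem_zip, hje]
    obtain ⟨⟨d, e⟩, -, he⟩ := Forall₂_exists_right h ht
    exact mem_accepted_of_entryUTI (List.of_mem_zip ht).1 he rfl hs hb

theorem matchSig_testBody (v : Format) (q a i e : Term) :
    matchSig pkA v (sign (triple q a i) skA) (testBody v q a i e)
      (sign (testBody v q a i e) skA) = true := by
  cases v <;> simp [matchSig, testBody]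

/-- Completeness for a single entry: injectivity forces the openings to be the coins, signatures and
pseudonyms of the two ciphertexts. -/
theorem entryUTI_of_contents {v : Format} {ex : PseudoPost} {q a i r m s c m₁ m₂ : Term}
    {d e : Opening} {receipt notif : Term}
    (hr : receipt = enc (pair (triple q a i) (sign (triple q a i) skA)) i r)
    (hs : checkSign s ex.pseudonym = some (triple (testBody v q a i ex.pseudonym)
      (sign (testBody v q a i ex.pseudonym) skA) m))
    (hn : notif = enc (pair (triple (testBody v q a i ex.pseudonym)
      (sign (testBody v q a i ex.pseudonym) skA) m) s) i c)
    (hd : receipt = enc (pair m₁ d.sig) d.pseudonym d.coin)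
    (he : notif = enc (pair m₂ e.sig) e.pseudonym e.coin) :
    entryUTI v pkA ex receipt notif d e = true := by
  obtain ⟨dc, ds, dp⟩ := d
  obtain ⟨ec, es, ep⟩ := e
  subst hr hn
  simp only [enc.injEq, pair.injEq] at hd he
  obtain ⟨⟨rfl, rfl⟩, rfl, rfl⟩ := hd
  obtain ⟨⟨rfl, rfl⟩, rfl, rfl⟩ := he
  exact entryUTI_iff.2 ⟨q, a, _, _, m, checkSign_sign_pk _ _, hs, readBody_testBody _ _ _ _ _,
    rfl, rfl, matchSig_testBody _ _ _ _ _, rfl⟩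

theorem testUTM_of_honest (hE : E.Honest) : E.testUTM = true := by
  obtain ⟨hT, -, -, hdr, hdn, -, -⟩ := hE
  refine (all₂_iff _ _ _).2 (Forall₂_of_mem_zip hdn ?_)
  rintro t e ht ⟨m₂, hte⟩
  obtain ⟨q, a, i, m, s, r, c, hr, hs, he⟩ := E.valid.notification_of_not_active hT ht
  obtain ⟨d, hmem, m₁, hrd⟩ := Forall₂_exists_right hdr hr
  exact List.any_eq_true.2 ⟨_, hmem, entryUTI_of_contents rfl hs he hrd hte⟩

/-- In honest executions the receipts and notifications correspond to each other one by one if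
all accepted tests are marked in the order of acceptance. -/
theorem recipients_eq (hE : E.Honest) (ho : E.SameOrder)
    (h : ∀ i x, (i, x) ∈ E.exam.Accepted → ∃ m, (i, x, m) ∈ E.exam.Marked) :
    E.notifs.map recipient = E.receipts.map recipient := by
  have hT := hE.1
  -- A sublist that is at least as long as the whole list equals it. The length bound holds because
  -- the distinct recipients of receipts all occur among those of notifications.
  refine ho.eq_of_length_le (List.Subperm.length_le
    ((E.valid.nodup_receipt_of_not_active hT).subperm ?_))
  intro p hp
  obtain ⟨t, ht, rfl⟩ := List.mem_map.1 hp
  obtain ⟨p, q, a, r, -, -, rfl⟩ := E.valid.receipt_of_not_active hT ht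
  obtain ⟨m, ma, sma, p', r', body, sca, hn, hs, hb⟩ := h _ _ (mem_accepted_of_mem_receipts ht)
  refine List.mem_map.2 ⟨_, hn, ?_⟩
  -- `Marked` does not constrain the encryption key; the honest shape shows that it is the pseudonym
  -- in the test.
  obtain ⟨q', a', i', m', s', r'', c, -, hs', he⟩ := E.valid.notification_of_not_active hT hn
  injection he with he h1
  injection he with _ he
  subst he
  rw [hs'] at hs
  injection hs with hs
  injection hs with hs
  subst hs
  rw [readBody_testBody] at hb
  simp only [Option.some.injEq, Prod.mk.injEq] at hb
  simp [recipient, h1, hb.2.2]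

theorem testUTI_of_honest (hE : E.Honest) (ho : E.SameOrder)
    (h : ∀ i x, (i, x) ∈ E.exam.Accepted → ∃ m, (i, x, m) ∈ E.exam.Marked) :
    E.testUTI = true := by
  have heq := recipients_eq hE ho h
  obtain ⟨hT, -, -, hdr, hdn, -, -⟩ := hE
  have hlen : E.notifs.length = E.receipts.length := by
    simpa using congrArg List.length heq
  have hlr := hdr.length_eq
  have hln := hdn.length_eq
  simp only [Execution.testUTI, Remark.testUTI, Bool.and_eq_true, decide_eq_true_eq,
    all₂_iff]
  refine ⟨hlen.symm, List.forall₂_iff_get.2 ⟨by simp; omega, ?_⟩⟩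
  intro j hj hj'
  simp only [List.length_zip] at hj hj'
  have hjr : j < E.receipts.length := by omega
  have hjn : j < E.notifs.length := by omega
  have hjd : j < E.receiptData.length := by omega
  have hje : j < E.notifData.length := by omega
  simp only [List.get_eq_getElem, List.getElem_zip]
  obtain ⟨m₁, h₁⟩ := (List.forall₂_iff_get.1 hdr).2 j hjr hjd
  obtain ⟨m₂, h₂⟩ := (List.forall₂_iff_get.1 hdn).2 j hjn hje
  obtain ⟨q, a, i, m, s, r, c, hr, hs, hn⟩ :=
    E.valid.notification_of_not_active hT (List.getElem_mem hjn)
  have hrec : recipient E.receipts[j] = some i := by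
    have : (E.notifs.map recipient)[j]'(by simpa) = (E.receipts.map recipient)[j]'(by simpa) := by
      simp only [heq]
    rw [List.getElem_map, List.getElem_map] at this
    rw [← this]
    exact congrArg recipient hn
  -- The receipt behind the `j`-th notification and the `j`-th receipt have the same recipient, so
  -- they are the same ciphertext.
  have hrj := List.inj_on_of_nodup_map (E.valid.nodup_receipt_of_not_active hT)
    (List.getElem_mem hjr) hr hrec
  exact entryUTI_of_contents hrj hs hn h₁ h₂

/-! ### Mark Integrity. -/

/-- `Assigned` reads the key and the plaintext, `Marked` the signature. Re-encryption puts the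
signed triple in the plaintext and uses the pseudonym of the signed test as key, so both read the
same data. -/
theorem markIntegrity_of_testUMI (h : E.testUMI = true) : E.exam.MarkIntegrity := by
  have h := (all₂_iff _ _ _).1 h
  ext ⟨i, m⟩
  constructor
  · rintro ⟨body, sca, sma, r, hn⟩
    obtain ⟨e, -, he⟩ := Forall₂_exists_right h hn
    obtain ⟨body', sca', m', q, a, i', h1, h2, h3⟩ := entryUMI_iff.1 he
    simp only [enc.injEq, pair.injEq, triple.injEq] at h3
    obtain ⟨⟨⟨rfl, rfl, rfl⟩, rfl⟩, rfl, rfl⟩ := h3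
    exact ⟨(q, a), _, _, _, _, _, _, hn, h1, h2⟩
  · rintro ⟨⟨q, a⟩, ma, sma, p, r, body, sca, hn, hs, hb⟩
    obtain ⟨e, -, he⟩ := Forall₂_exists_right h hn
    obtain ⟨body', sca', m', q', a', i', h1, h2, h3⟩ := entryUMI_iff.1 he
    simp only [enc.injEq, pair.injEq] at h3
    obtain ⟨⟨rfl, rfl⟩, rfl, rfl⟩ := h3
    obtain ⟨rfl, rfl, rfl⟩ : body' = body ∧ sca' = sca ∧ m' = m := by simpa [h1] using hs
    obtain ⟨rfl, rfl, rfl⟩ : q' = q ∧ a' = a ∧ p = i := by simpa [h2] using hb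
    exact ⟨_, _, _, _, hn⟩

theorem testUMI_of_honest (hE : E.Honest) : E.testUMI = true := by
  obtain ⟨hT, -, -, -, hdn, -, -⟩ := hE
  refine (all₂_iff _ _ _).2 (Forall₂_of_mem_zip hdn ?_)
  rintro t ⟨ec, es, ep⟩ ht ⟨m₂, hte⟩
  obtain ⟨q, a, i, m, s, r, c, -, hs, rfl⟩ := E.valid.notification_of_not_active hT ht
  simp only [enc.injEq, pair.injEq] at hte
  obtain ⟨⟨rfl, rfl⟩, rfl, rfl⟩ := hte
  exact entryUMI_iff.2 ⟨_, _, _, _, _, _, hs, readBody_testBody _ _ _ _ _, rfl⟩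

end Execution

end Remark

theorem mainTheorem2 :
    -- Registration
    ((∀ E : Remark.Execution, Remark.Principal.net ∉ E.threat.corrupt →
        E.testUR = true → E.exam.Registration) ∧
      (∀ E : Remark.Execution, E.Honest → E.exam.Registration → E.testUR = true)) ∧
    -- Marking Correctness, with an honest exam authority
    ((∀ E : Remark.Execution, Remark.Principal.ea ∉ E.threat.corrupt → E.HonestData →
        E.testUMC = true → E.exam.MarkingCorrectness) ∧
      (∀ E : Remark.Execution, E.Honest → E.exam.MarkingCorrectness → E.testUMC = true)) ∧
    -- Test Integrity
    ((∀ E : Remark.Execution, E.testUTI = true → E.exam.TestIntegrity) ∧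
      (∀ E : Remark.Execution, E.Honest → E.SameOrder →
        E.exam.TestIntegrity → E.testUTI = true)) ∧
    -- Test Markedness
    ((∀ E : Remark.Execution, E.testUTM = true → E.exam.TestMarkedness) ∧
      (∀ E : Remark.Execution, E.Honest → E.exam.TestMarkedness → E.testUTM = true)) ∧
    -- Mark Integrity
    ((∀ E : Remark.Execution, E.testUMI = true → E.exam.MarkIntegrity) ∧
      (∀ E : Remark.Execution, E.Honest → E.exam.MarkIntegrity → E.testUMI = true)) ∧
    -- in every complete honest execution with correct marks, all five tests succeed
    (∀ E : Remark.Execution, E.Honest → E.SameOrder →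
      (∀ i x, (i, x) ∈ E.exam.Accepted → ∃ m, (i, x, m) ∈ E.exam.Marked) →
      E.exam.MarkingCorrectness →
        E.testUR = true ∧ E.testUMC = true ∧ E.testUTI = true ∧ E.testUTM = true ∧
          E.testUMI = true) := by
  refine ⟨⟨fun E => Remark.Execution.registration_of_testUR,
      fun E hE _ => Remark.Execution.testUR_of_honest hE⟩,
    ⟨fun E _ => Remark.Execution.markingCorrectness_of_testUMC,
      fun E => Remark.Execution.testUMC_of_honest⟩,
    ⟨fun E => Remark.Execution.testIntegrity_of_testUTI, fun E hE ho h =>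
      Remark.Execution.testUTI_of_honest hE ho fun i x hx => ?_⟩,
    ⟨fun E => Remark.Execution.testMarkedness_of_testUTM,
      fun E hE _ => Remark.Execution.testUTM_of_honest hE⟩,
    ⟨fun E => Remark.Execution.markIntegrity_of_testUMI,
      fun E hE _ => Remark.Execution.testUMI_of_honest hE⟩,
    fun E hE ho hmarked hcorrect => ⟨Remark.Execution.testUR_of_honest hE,
      Remark.Execution.testUMC_of_honest hE hcorrect,
      Remark.Execution.testUTI_of_honest hE ho hmarked,
      Remark.Execution.testUTM_of_honest hE, Remark.Execution.testUMI_of_honest hE⟩⟩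
  -- Test Integrity, read from left to right, says that each accepted test is marked.
  rw [show E.exam.Accepted = _ from h] at hx
  exact hx
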